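/- Let $Q\to\mathbb R$ be a smooth fibre bundle over the time axis, with bundle coordinates $(t,q^i)$ and jet coordinates $q^i_\Lambda$, where $\Lambda=(t\cdots t)$ is a multi-index of length $|\Lambda|\ge 0$. Let $E\to\mathbb R$ be a smooth vector bundle of finite rank, with linear bundle coordinates $(t,\chi^a)$ and jet coordinates $\chi^a_\Lambda$. Let $d_t=\partial_t+\sum_{\Lambda}\bigl(q^i_{t\Lambda}\,\partial/\partial q^i_\Lambda+\chi^a_{t\Lambda}\,\partial/\partial \chi^a_\Lambda\bigr)$ be the total derivative, $d_\Lambda=(d_t)^{|\Lambda|}$, and $d_H\sigma=d_t\sigma\,dt$ for functions $\sigma$ on jet manifolds. Let $L=\mathcal L\,dt$ be a Lagrangian, where $\mathcal L$ is a smooth function on a finite order jet manifold $J^rQ$, and let $$\delta L=\mathcal E_i\,(dq^i-q^i_t\,dt)\wedge dt,\qquad \mathcal E_i=\sum_{0\le|\Lambda|}(-1)^{|\Lambda|}d_\Lambda\Bigl(\frac{\partial\mathcal L}{\partial q^i_\Lambda}\Bigr)$$ be its Lagrange operator. A (vertical) gauge symmetry of $L$ parameterized by sections of $E\to\mathbb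 R$ is a smooth section $u$, over $J^kQ\times_{\mathbb R}J^mE$ for some $k,m\ge 0$, of the pull-back of the vertical tangent bundle of $Q\to\mathbb R$, such that $u$ is linear in the jets of the gauge parameters, i.e. in all bundle coordinates $$u=\Bigl(\sum_{0\le|\Lambda|\le m}u^{i\Lambda}_a(t,q^j_\Sigma)\,\chi^a_\Lambda\Bigr)\partial_i ,$$ and such that $u\rfloor\delta L=d_H\sigma$, i.e. $u^i\mathcal E_i=d_t\sigma$ with $u^i$ the components of $u$, for some smooth function $\sigma$ on a finite order jet manifold of $Q\times_{\mathbb R}E$. Theorem. If $u$ is a gauge symmetry of a Lagrangian $L$, then the Lagrange operator of $L$ satisfies the Noether identities: in all bundle coordinates on $Q$ and all linear bundle coordinates on $E$, for every $a$, $$\sum_{0\le|\Lambda|\le m}(-1)^{|\Lambda|}d_\Lambda\bigl(u^{i\Lambda}_a\,\mathcal E_i\bigr)=0 .$$ -/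

import Mathlib

open scoped Manifold ContDiff Topology
open Bundle Filter

noncomputable section

namespace GaugeNoether

/-! ### Calculus in adapted jet coordinates

Points of the infinite order jet space of a coordinate chart are written `(t, w)`, where `w l i` is
the jet coordinate `q^i_Λ` with `|Λ| = l` (the base is the time axis `ℝ`, so that a multi-index
`Λ = (t⋯t)` is determined by its length). The index type `ι` numbers the fibre coordinates. -/

/-- Adapted coordinates `(t, q^i, q^i_t, q^i_tt, …)`. -/
abbrev JetCoord (ι : Type*) : Type _ := ℝ × (ℕ → ι → ℝ)

section Coordinates

variable {ι : Type*} [Fintype ι] [DecidableEq ι]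

/-- The partial derivative `∂_i^Λ f = ∂f/∂q^i_Λ`, `|Λ| = l`. -/
def jetPartial (l : ℕ) (i : ι) (f : JetCoord ι → ℝ) : JetCoord ι → ℝ := fun p =>
  deriv (fun x : ℝ => f (p.1, Function.update p.2 l (Function.update (p.2 l) i x))) (p.2 l i)

/-- The total derivative `d_t f = ∂_t f + ∑_Λ q^i_{tΛ} ∂_i^Λ f`. The sum over the jet order is
finite for a function that depends on finitely many jet coordinates. -/
def totalDeriv (f : JetCoord ι → ℝ) : JetCoord ι → ℝ := fun p =>
  deriv (fun τ : ℝ => f (τ, p.2)) p.1 + ∑ᶠ l : ℕ, ∑ i, p.2 (l + 1) i * jetPartial l i f p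

/-- The variational derivative `ℰ_i = ∑_Λ (-1)^|Λ| d_Λ (∂_i^Λ f)`. -/
def variationalDeriv (i : ι) (f : JetCoord ι → ℝ) : JetCoord ι → ℝ := fun p =>
  ∑ᶠ l : ℕ, (-1 : ℝ) ^ l * (totalDeriv^[l] (jetPartial l i f)) p

end Coordinates

/-! ### Fibre bundles over the time axis and their jets -/

section Jets

variable {EY : Type*} [NormedAddCommGroup EY] [NormedSpace ℝ EY] {H : Type*} [TopologicalSpace H]
  (I : ModelWithCorners ℝ EY H) {Y : Type*} [TopologicalSpace Y] [ChartedSpace H Y]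

/-- `pr : Y → ℝ` is a smooth fibre bundle with typical fibre the `n`-dimensional manifold `M`: over
a neighbourhood `U` of every time, `Y` is diffeomorphic over `U` to `U × M`. -/
def IsSmoothFibreBundle (pr : Y → ℝ) (n : ℕ) (M : Type*) [TopologicalSpace M]
    [ChartedSpace (EuclideanSpace ℝ (Fin n)) M] : Prop :=
  ∀ t₀ : ℝ, ∃ (U : Set ℝ) (ψ : OpenPartialHomeomorph Y (ℝ × M)),
    IsOpen U ∧ t₀ ∈ U ∧ ψ.source = pr ⁻¹' U ∧ ψ.target = U ×ˢ Set.univ ∧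
    ContMDiffOn I (𝓘(ℝ, ℝ).prod (𝓡 n)) ∞ ψ ψ.source ∧
    ContMDiffOn (𝓘(ℝ, ℝ).prod (𝓡 n)) I ∞ ψ.symm ψ.target ∧
    ∀ y ∈ ψ.source, (ψ y).1 = pr y

/-- Fibred coordinates `(t, y^1, …, y^n)` on an open subset of `Y`: a diffeomorphism of an open
subset of `Y` onto an open subset of `ℝ × ℝ^n` whose first component is `pr`. -/
structure FibredChart (pr : Y → ℝ) (n : ℕ) extends OpenPartialHomeomorph Y (ℝ × (Fin n → ℝ)) where
  smooth_toFun : ContMDiffOn I 𝓘(ℝ, ℝ × (Fin n → ℝ)) ∞ toOpenPartialHomeomorph source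
  smooth_invFun :
    ContMDiffOn 𝓘(ℝ, ℝ × (Fin n → ℝ)) I ∞ toOpenPartialHomeomorph.symm target
  fst_eq : ∀ y ∈ source, (toOpenPartialHomeomorph y).1 = pr y

/-- `s` is a smooth section of `pr` on a neighbourhood of the time `t`. -/
def IsLocalSection (pr : Y → ℝ) (t : ℝ) (s : ℝ → Y) : Prop :=
  ∀ᶠ τ in 𝓝 t, ContMDiffAt 𝓘(ℝ, ℝ) I ∞ s τ ∧ pr (s τ) = τ

/-- Two local sections at `t` have the same `k`-jet at `t`: they have the same value and, in fibred
coordinates, the same derivatives up to order `k`. -/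
def jetSetoid (pr : Y → ℝ) (n k : ℕ) (t : ℝ) : Setoid {s : ℝ → Y // IsLocalSection I pr t s} where
  r s s' := s.1 t = s'.1 t ∧ ∀ φ : FibredChart I pr n, s.1 t ∈ φ.source → ∀ l ≤ k,
    iteratedDeriv l (fun τ => (φ.toOpenPartialHomeomorph (s.1 τ)).2) t =
      iteratedDeriv l (fun τ => (φ.toOpenPartialHomeomorph (s'.1 τ)).2) t
  iseqv :=
    { refl := fun _ => ⟨rfl, fun _ _ _ _ => rfl⟩
      symm := fun h => ⟨h.1.symm, fun φ hs l hl => (h.2 φ (h.1 ▸ hs) l hl).symm⟩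
      trans := fun h h' => ⟨h.1.trans h'.1,
        fun φ hs l hl => (h.2 φ hs l hl).trans (h'.2 φ (h.1 ▸ hs) l hl)⟩ }

/-- The fibre over the time `t` of the jet manifold `J^k Y` of the bundle `pr : Y → ℝ` with
`n`-dimensional fibres. The jet manifold is the disjoint union of these fibres, and the jet manifold
of a fibred product over `ℝ` has as fibres the products of the fibres. -/
def Jet (pr : Y → ℝ) (n k : ℕ) (t : ℝ) : Type _ := Quotient (jetSetoid I pr n k t)

variable {I}

/-- The projection `J^k Y → Y`, `j^k_t s ↦ s t`. -/
def Jet.point {pr : Y → ℝ} {n k : ℕ} {t : ℝ} (j : Jet I pr n k t) : Y :=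
  Quotient.lift (fun s : {s : ℝ → Y // IsLocalSection I pr t s} => s.1 t) (by intro s s' h; exact h.1) j

/-- The local section that is polynomial in fibred coordinates, with given derivatives
`y 0, …, y k` at the time `t`. -/
def polySection {pr : Y → ℝ} {n : ℕ} (φ : FibredChart I pr n) (k : ℕ) (t : ℝ)
    (y : Fin (k + 1) → Fin n → ℝ) : ℝ → Y := fun τ =>
  φ.toOpenPartialHomeomorph.symm
    (τ, ∑ l : Fin (k + 1), ((τ - t) ^ (l : ℕ) / (Nat.factorial (l : ℕ) : ℝ)) • y l)

theorem isLocalSection_polySection {pr : Y → ℝ} {n : ℕ} (φ : FibredChart I pr n) (k : ℕ) (t : ℝ)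
    (y : Fin (k + 1) → Fin n → ℝ) (h : (t, y 0) ∈ φ.target) :
    IsLocalSection I pr t (polySection φ k t y) := by
  have hc : ContDiff ℝ ∞ (fun τ : ℝ => ((τ,
      ∑ l : Fin (k + 1), ((τ - t) ^ (l : ℕ) / (Nat.factorial (l : ℕ) : ℝ)) • y l) :
        ℝ × (Fin n → ℝ))) := by
    fun_prop
  have h0 : (∑ l : Fin (k + 1), ((t - t) ^ (l : ℕ) / (Nat.factorial (l : ℕ) : ℝ)) • y l) = y 0 := by
    rw [Fin.sum_univ_succ]
    simp
  have hmem : ∀ᶠ τ in 𝓝 t, ((τ,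
      ∑ l : Fin (k + 1), ((τ - t) ^ (l : ℕ) / (Nat.factorial (l : ℕ) : ℝ)) • y l) :
        ℝ × (Fin n → ℝ)) ∈ φ.target := by
    apply hc.continuous.continuousAt.eventually_mem
    apply φ.open_target.mem_nhds
    simpa only [h0] using h
  filter_upwards [hmem] with τ hτ
  refine ⟨?_, ?_⟩
  · have h1 := (φ.smooth_invFun.contMDiffAt (φ.open_target.mem_nhds hτ))
    exact ContMDiffAt.comp τ h1 hc.contMDiff.contMDiffAt
  · have h2 := φ.fst_eq _ (φ.toOpenPartialHomeomorph.map_target hτ)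
    rw [φ.toOpenPartialHomeomorph.right_inv hτ] at h2
    exact h2.symm

/-- The `k`-jet at the time `t` whose adapted coordinates are `y 0, …, y k`. -/
def FibredChart.jet {pr : Y → ℝ} {n : ℕ} (φ : FibredChart I pr n) (k : ℕ) (t : ℝ)
    (y : Fin (k + 1) → Fin n → ℝ) (h : (t, y 0) ∈ φ.target) : Jet I pr n k t :=
  Quotient.mk (jetSetoid I pr n k t) ⟨polySection φ k t y, isLocalSection_polySection φ k t y h⟩

open Classical in
/-- The expression of a function on `J^k Y` in adapted coordinates (and `0` outside the range of
the coordinates). -/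
def coordFun {pr : Y → ℝ} {n k : ℕ} (f : ∀ t, Jet I pr n k t → ℝ) (φ : FibredChart I pr n) :
    ℝ × (Fin (k + 1) → Fin n → ℝ) → ℝ := fun p =>
  if h : (p.1, p.2 0) ∈ φ.target then f p.1 (φ.jet k p.1 p.2 h) else 0

/-- Smooth functions on the jet manifold `J^k Y`. -/
def IsSmoothOnJets {pr : Y → ℝ} {n k : ℕ} (f : ∀ t, Jet I pr n k t → ℝ) : Prop :=
  ∀ φ : FibredChart I pr n, ContDiffOn ℝ ∞ (coordFun f φ) {p | (p.1, p.2 0) ∈ φ.target}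

/-- The coordinate expression of a function on `J^k Y` pulled back to the infinite order jets. -/
def coordExpr {pr : Y → ℝ} {n k : ℕ} (f : ∀ t, Jet I pr n k t → ℝ) (φ : FibredChart I pr n) :
    JetCoord (Fin n) → ℝ := fun p => coordFun f φ (p.1, fun l => p.2 l)

/-- The coefficients `ℰ_i` of the Lagrange operator `δL = ℰ_i θ^i ∧ dt` of the Lagrangian
`L = 𝓛 dt` in a fibred chart. -/
def lagrangeOperator {pr : Y → ℝ} {n r : ℕ} (L : ∀ t, Jet I pr n r t → ℝ) (φ : FibredChart I pr n)
    (i : Fin n) : JetCoord (Fin n) → ℝ := variationalDeriv i (coordExpr L φ)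

end Jets

/-! ### Gauge symmetries -/

section Gauge

variable {EQ : Type*} [NormedAddCommGroup EQ] [NormedSpace ℝ EQ] {H : Type*} [TopologicalSpace H]
  {I : ModelWithCorners ℝ EQ H} {Q : Type*} [TopologicalSpace Q] [ChartedSpace H Q]
  {d : ℕ} {V : ℝ → Type*} [∀ t, AddCommGroup (V t)] [∀ t, Module ℝ (V t)]
  [∀ t, TopologicalSpace (V t)] [TopologicalSpace (TotalSpace (EuclideanSpace ℝ (Fin d)) V)]
  [FiberBundle (EuclideanSpace ℝ (Fin d)) V]

variable (d V) in
/-- Fibred coordinates `(t, χ^1, …, χ^d)` on the total space of the bundle `V → ℝ` with typical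
fibre `ℝ^d`. -/
abbrev ParamChart : Type _ :=
  FibredChart (𝓘(ℝ, ℝ).prod 𝓘(ℝ, EuclideanSpace ℝ (Fin d)))
    (TotalSpace.proj : TotalSpace (EuclideanSpace ℝ (Fin d)) V → ℝ) d

variable (d V) in
/-- The fibre over `t` of the jet manifold `J^m V` of the bundle of gauge parameters. -/
abbrev ParamJet (m : ℕ) (t : ℝ) : Type _ :=
  Jet (𝓘(ℝ, ℝ).prod 𝓘(ℝ, EuclideanSpace ℝ (Fin d)))
    (TotalSpace.proj : TotalSpace (EuclideanSpace ℝ (Fin d)) V → ℝ) d m t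

/-- Linear bundle coordinates: they are defined over an open set of times and are linear
isomorphisms on the fibres. -/
def ParamChart.IsLinear (ψ : ParamChart d V) : Prop :=
  ∃ B : Set ℝ, IsOpen B ∧ ψ.source = TotalSpace.proj ⁻¹' B ∧ ψ.target = B ×ˢ Set.univ ∧
    ∀ t ∈ B, IsLinearMap ℝ (fun v : V t =>
      (ψ.toOpenPartialHomeomorph (TotalSpace.mk' (EuclideanSpace ℝ (Fin d)) t v)).2)

open Classical in
/-- The expression of a function on `J^k Q ×_ℝ J^m V` in adapted coordinates (and `0` outside the
range of the coordinates). -/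
def coordFun₂ {pr : Q → ℝ} {n k m : ℕ} (f : ∀ t, Jet I pr n k t → ParamJet d V m t → ℝ)
    (φ : FibredChart I pr n) (ψ : ParamChart d V) :
    ℝ × (Fin (k + 1) → Fin n → ℝ) × (Fin (m + 1) → Fin d → ℝ) → ℝ := fun p =>
  if h : (p.1, p.2.1 0) ∈ φ.target ∧ (p.1, p.2.2 0) ∈ ψ.target then
    f p.1 (φ.jet k p.1 p.2.1 h.1) (ψ.jet m p.1 p.2.2 h.2)
  else 0

/-- `f` is smooth on `J^k Q ×_ℝ J^m V`, tested over the domains of the given fibred chart of `Q`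
and of all linear bundle coordinates of `V`. -/
def IsSmoothOver {pr : Q → ℝ} {n k m : ℕ} (f : ∀ t, Jet I pr n k t → ParamJet d V m t → ℝ)
    (φ : FibredChart I pr n) : Prop :=
  ∀ ψ : ParamChart d V, ψ.IsLinear → ContDiffOn ℝ ∞ (coordFun₂ f φ ψ)
    {p | (p.1, p.2.1 0) ∈ φ.target ∧ (p.1, p.2.2 0) ∈ ψ.target}

/-- The coordinate expression of a function on `J^k Q ×_ℝ J^m V` pulled back to the infinite order
jets of `Q ×_ℝ V`, with fibre coordinates `(q^i, χ^a)`. -/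
def coordExpr₂ {pr : Q → ℝ} {n k m : ℕ} (f : ∀ t, Jet I pr n k t → ParamJet d V m t → ℝ)
    (φ : FibredChart I pr n) (ψ : ParamChart d V) : JetCoord (Fin n ⊕ Fin d) → ℝ := fun p =>
  coordFun₂ f φ ψ (p.1, fun l i => p.2 l (Sum.inl i), fun l a => p.2 l (Sum.inr a))

/-- The projection of infinite order jets of `Q ×_ℝ V` onto those of `Q` in coordinates. -/
def toQ {n : ℕ} (p : JetCoord (Fin n ⊕ Fin d)) : JetCoord (Fin n) :=
  (p.1, fun l i => p.2 l (Sum.inl i))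

/-- The range of the adapted coordinates on the infinite order jets of `Q ×_ℝ V`. -/
def coordDomain {pr : Q → ℝ} {n : ℕ} (φ : FibredChart I pr n) (ψ : ParamChart d V) :
    Set (JetCoord (Fin n ⊕ Fin d)) :=
  {p | (p.1, fun i => p.2 0 (Sum.inl i)) ∈ φ.target ∧ (p.1, fun a => p.2 0 (Sum.inr a)) ∈ ψ.target}

/-- The component `u^i` of `u = u^i ∂_i` in a fibred chart of `Q`: the derivative of the coordinate
function `q^i` along `u`. -/
def component {pr : Q → ℝ} {n k m : ℕ}
    (u : ∀ t, (j : Jet I pr n k t) → ParamJet d V m t → TangentSpace I j.point)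
    (φ : FibredChart I pr n) (i : Fin n) : ∀ t, Jet I pr n k t → ParamJet d V m t → ℝ :=
  fun t j e =>
    (show ℝ × (Fin n → ℝ) from
      mfderiv I 𝓘(ℝ, ℝ × (Fin n → ℝ)) φ.toOpenPartialHomeomorph j.point (u t j e)).2 i

/-- A vertical generalized vector field `u` on `Q ×_ℝ V` which lives in `TQ`: a smooth section
over `J^k Q ×_ℝ J^m V` of the pull-back of the vertical tangent bundle of `Q → ℝ`. -/
structure IsVerticalGeneralizedField {pr : Q → ℝ} {n k m : ℕ}
    (u : ∀ t, (j : Jet I pr n k t) → ParamJet d V m t → TangentSpace I j.point) : Prop where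
  vertical : ∀ t j e, mfderiv I 𝓘(ℝ, ℝ) pr j.point (u t j e) = 0
  smooth : ∀ (φ : FibredChart I pr n) (i : Fin n), IsSmoothOver (component u φ i) φ

/-- In the given coordinates, `u = (∑_{|Λ| ≤ m} c^{iΛ}_a (t, q^j_Σ) χ^a_Λ) ∂_i`. -/
def HasCoefficients {pr : Q → ℝ} {n k m : ℕ}
    (u : ∀ t, (j : Jet I pr n k t) → ParamJet d V m t → TangentSpace I j.point)
    (φ : FibredChart I pr n) (ψ : ParamChart d V)
    (c : Fin n → ℕ → Fin d → JetCoord (Fin n) → ℝ) : Prop :=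
  ∀ i, ∀ p ∈ coordDomain φ ψ, coordExpr₂ (component u φ i) φ ψ p =
    ∑ l ∈ Finset.range (m + 1), ∑ a, c i l a (toQ p) * p.2 l (Sum.inr a)

/-- `u` is a vertical gauge symmetry of the Lagrangian `L = 𝓛 dt` parameterized by sections of the
vector bundle `V → ℝ`: it is a vertical generalized vector field on `Q ×_ℝ V` which lives in `TQ`,
it is linear in the jets of the gauge parameters, and `u ⌋ δL = d_H σ` for a smooth function `σ` on
a finite order jet manifold of `Q ×_ℝ V`. -/
structure IsVerticalGaugeSymmetry {pr : Q → ℝ} {n r k m : ℕ} (L : ∀ t, Jet I pr n r t → ℝ)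
    (u : ∀ t, (j : Jet I pr n k t) → ParamJet d V m t → TangentSpace I j.point) : Prop where
  field : IsVerticalGeneralizedField u
  linear : ∀ (φ : FibredChart I pr n) (ψ : ParamChart d V), ψ.IsLinear →
    ∃ c, HasCoefficients u φ ψ c
  exact : ∃ (s : ℕ) (σ : ∀ t, Jet I pr n s t → ParamJet d V s t → ℝ),
    (∀ φ, IsSmoothOver σ φ) ∧
    ∀ (φ : FibredChart I pr n) (ψ : ParamChart d V), ψ.IsLinear → ∀ p ∈ coordDomain φ ψ,
      ∑ i, coordExpr₂ (component u φ i) φ ψ p * lagrangeOperator L φ i (toQ p) =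
        totalDeriv (coordExpr₂ σ φ ψ) p

end Gauge

end GaugeNoether

end

/-!
The identity `u^i ℰ_i = d_t σ` is linear in the jet coordinates `χ^a_Λ` of the gauge parameters on
its left-hand side: with `g_l = ∑_i u^{iΛ}_a ℰ_i`, `|Λ| = l`, that side is a sum of terms
`g_l χ^a_Λ`. Fix `a` and differentiate the identity with respect to `χ^a_Λ` at `χ = 0`. Since
`∂/∂χ^a_Λ` commutes with `d_t` up to the partial derivative of one order less
(`Represents.jetPartial_totalDeriv`, the symmetry of second derivatives), and since `d_t` restricts
to jets with `χ = 0` (`totalDeriv_withZeroParam`), the functions `S_l = ∂σ/∂χ^a_Λ` at `χ = 0`,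
`|Λ| = l`, satisfy

  `g_0 = d_t S_0`,  `g_{l+1} = d_t S_{l+1} + S_l`.

Hence the alternating sum of the `d_t^l g_l` telescopes (`sum_iterate_totalDeriv_eq`) to
`± d_t^{N+1} S_N`, which vanishes once `N` exceeds the order of `σ`. This is the statement that the
variational derivative with respect to `χ^a` kills total derivatives, applied to `d_t σ`.

Functions on the infinite order jets are handled through smooth functions on jets of finite order
that represent them over an open set (`IsFiniteOrder`). On such functions `d_t` is the Fréchet
derivative along `∂_t + ∑ q^i_{tΛ} ∂_i^Λ` (`Represents.totalDeriv_eq`), so its defining sum is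
finite and it is additive. Outside the coordinate domain nothing is known about the functions
involved. This does not matter because partial and total derivatives are local
(`jetPartial_congr`, `totalDeriv_congr`).
-/

open scoped Manifold ContDiff Topology
open Bundle Filter

noncomputable section

namespace GaugeNoether

/-! ### Functions of finite order on the infinite order jets -/

section FiniteOrder

variable {ι : Type*}

/-- The points of the infinite order jet space whose zeroth order part `(t, q^i)` lies in `U`. -/
def jetDomain (U : Set (ℝ × (ι → ℝ))) : Set (JetCoord ι) := {p | (p.1, p.2 0) ∈ U}

/-- The points of the jet space of order `k` whose zeroth order part lies in `U`. -/
def finiteJetDomain (k : ℕ) (U : Set (ℝ × (ι → ℝ))) : Set (ℝ × (Fin (k + 1) → ι → ℝ)) :=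
  {x | (x.1, x.2 0) ∈ U}

/-- The projection of the infinite order jets onto the jets of order `k`. -/
def truncate (k : ℕ) (p : JetCoord ι) : ℝ × (Fin (k + 1) → ι → ℝ) := (p.1, fun l => p.2 l)

/-- `F` is a smooth function on the jets of order `k` over `U` whose pull-back to the infinite
order jets is `f`. -/
structure Represents [Fintype ι] (U : Set (ℝ × (ι → ℝ))) (k : ℕ)
    (F : ℝ × (Fin (k + 1) → ι → ℝ) → ℝ) (f : JetCoord ι → ℝ) : Prop where
  smooth : ContDiffOn ℝ ∞ F (finiteJetDomain k U)
  eqOn : ∀ p ∈ jetDomain U, f p = F (truncate k p)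

/-- `f` is, over `U`, the pull-back of a smooth function on the jets of some finite order. -/
def IsFiniteOrder [Fintype ι] (U : Set (ℝ × (ι → ℝ))) (f : JetCoord ι → ℝ) : Prop :=
  ∃ k F, Represents U k F f

/-- The coordinate vector `∂/∂q^i_Λ`, `|Λ| = l`, on the jets of order `k`; it is `0` if `k < l`. -/
def coordVec [DecidableEq ι] (k l : ℕ) (i : ι) : ℝ × (Fin (k + 1) → ι → ℝ) :=
  (0, fun j => if (j : ℕ) = l then Pi.single i 1 else 0)

theorem coordVec_eq_zero [DecidableEq ι] {k l : ℕ} (h : k < l) (i : ι) : coordVec k l i = 0 := by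
  ext j b
  · rfl
  · simp [coordVec, (show (j : ℕ) ≠ l by omega)]

variable {U : Set (ℝ × (ι → ℝ))} {f g : JetCoord ι → ℝ} {k : ℕ}

theorem isOpen_finiteJetDomain (hU : IsOpen U) (k : ℕ) : IsOpen (finiteJetDomain k U) :=
  hU.preimage (by fun_prop)

theorem truncate_mem {p : JetCoord ι} (hp : p ∈ jetDomain U) (k : ℕ) :
    truncate k p ∈ finiteJetDomain k U := hp

theorem eventually_update_mem [DecidableEq ι] (hU : IsOpen U) {p : JetCoord ι} (hp : p ∈ jetDomain U)
    (l : ℕ) (i : ι) : ∀ᶠ x in 𝓝 (p.2 l i),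
      ((p.1, Function.update p.2 l (Function.update (p.2 l) i x)) : JetCoord ι) ∈ jetDomain U := by
  have hc : Continuous fun x : ℝ =>
      ((p.1, Function.update p.2 l (Function.update (p.2 l) i x) 0) : ℝ × (ι → ℝ)) := by
    fun_prop
  exact hc.continuousAt.eventually_mem (hU.mem_nhds (by simpa [jetDomain] using hp))

theorem eventually_time_mem (hU : IsOpen U) {p : JetCoord ι} (hp : p ∈ jetDomain U) :
    ∀ᶠ τ in 𝓝 p.1, ((τ, p.2) : JetCoord ι) ∈ jetDomain U := by
  have hc : Continuous fun τ : ℝ => ((τ, p.2 0) : ℝ × (ι → ℝ)) := by fun_prop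
  exact hc.continuousAt.eventually_mem (hU.mem_nhds hp)

namespace Represents

variable [Fintype ι] {F G : ℝ × (Fin (k + 1) → ι → ℝ) → ℝ}

theorem contDiffAt (hF : Represents U k F f) (hU : IsOpen U) {x : ℝ × (Fin (k + 1) → ι → ℝ)}
    (hx : x ∈ finiteJetDomain k U) : ContDiffAt ℝ ∞ F x :=
  hF.smooth.contDiffAt ((isOpen_finiteJetDomain hU k).mem_nhds hx)

theorem differentiableAt (hF : Represents U k F f) (hU : IsOpen U)
    {x : ℝ × (Fin (k + 1) → ι → ℝ)} (hx : x ∈ finiteJetDomain k U) : DifferentiableAt ℝ F x :=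
  (hF.contDiffAt hU hx).differentiableAt (by simp)

theorem contDiffOn_fderiv (hF : Represents U k F f) (hU : IsOpen U) :
    ContDiffOn ℝ ∞ (fderiv ℝ F) (finiteJetDomain k U) :=
  hF.smooth.fderiv_of_isOpen (isOpen_finiteJetDomain hU k) (by simp)

/-- Pulling back to the jets of higher order. -/
theorem mono (hF : Represents U k F f) {k' : ℕ} (h : k ≤ k') :
    Represents U k' (fun x => F (x.1, fun j => x.2 (Fin.castLE (by omega) j))) f where
  smooth := hF.smooth.comp (t := finiteJetDomain k U) (by fun_prop) fun _ hx => hx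
  eqOn p hp := hF.eqOn p hp

theorem add (hF : Represents U k F f) (hG : Represents U k G g) :
    Represents U k (F + G) (f + g) where
  smooth := hF.smooth.add hG.smooth
  eqOn p hp := by simp [hF.eqOn p hp, hG.eqOn p hp]

theorem deriv_time_eq (hF : Represents U k F f) (hU : IsOpen U) {p : JetCoord ι}
    (hp : p ∈ jetDomain U) :
    deriv (fun τ : ℝ => f (τ, p.2)) p.1 = fderiv ℝ F (truncate k p) (1, 0) := by
  have hd : HasDerivAt (fun τ : ℝ => truncate k ((τ, p.2) : JetCoord ι)) (1, 0) p.1 :=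
    (hasDerivAt_id p.1).prodMk (hasDerivAt_const p.1 fun l : Fin (k + 1) => p.2 l)
  have hF' : HasFDerivAt F (fderiv ℝ F (truncate k p)) (truncate k ((p.1, p.2) : JetCoord ι)) :=
    (hF.differentiableAt hU (truncate_mem hp k)).hasFDerivAt
  refine Filter.EventuallyEq.deriv_eq ?_ |>.trans (hF'.comp_hasDerivAt _ hd).deriv
  filter_upwards [eventually_time_mem hU hp] with τ hτ
  exact hF.eqOn _ hτ

end Represents

/-- Two functions of finite order are represented on jets of a common order. -/
theorem IsFiniteOrder.exists_represents [Fintype ι] (hf : IsFiniteOrder U f)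
    (hg : IsFiniteOrder U g) :
    ∃ k F G, Represents U k F f ∧ Represents U k G g :=
  let ⟨k₁, _, hF⟩ := hf
  let ⟨k₂, _, hG⟩ := hg
  ⟨max k₁ k₂, _, _, hF.mono (le_max_left _ _), hG.mono (le_max_right _ _)⟩

/-! ### Locality of partial and total derivatives, and their expression through `fderiv` -/

variable [DecidableEq ι]

theorem jetPartial_congr (hU : IsOpen U) (h : Set.EqOn f g (jetDomain U)) (l : ℕ) (i : ι) :
    Set.EqOn (jetPartial l i f) (jetPartial l i g) (jetDomain U) := fun _ hp =>
  Filter.EventuallyEq.deriv_eq ((eventually_update_mem hU hp l i).mono fun _ hx => h hx)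

variable [Fintype ι]

theorem totalDeriv_congr (hU : IsOpen U) (h : Set.EqOn f g (jetDomain U)) :
    Set.EqOn (totalDeriv f) (totalDeriv g) (jetDomain U) := by
  intro p hp
  unfold totalDeriv
  congr 1
  · exact Filter.EventuallyEq.deriv_eq ((eventually_time_mem hU hp).mono fun _ hx => h hx)
  · exact finsum_congr fun l => Finset.sum_congr rfl fun i _ => by
      rw [jetPartial_congr hU h l i hp]

theorem totalDeriv_iterate_congr (hU : IsOpen U) (h : Set.EqOn f g (jetDomain U)) (N : ℕ) :
    Set.EqOn (totalDeriv^[N] f) (totalDeriv^[N] g) (jetDomain U) := by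
  induction N with
  | zero => exact h
  | succ N ih =>
    simp only [Function.iterate_succ', Function.comp_apply]
    exact totalDeriv_congr hU ih

theorem totalDeriv_zero : totalDeriv (0 : JetCoord ι → ℝ) = 0 := by
  funext p
  simp [totalDeriv, jetPartial]

theorem totalDeriv_iterate_zero (N : ℕ) : totalDeriv^[N] (0 : JetCoord ι → ℝ) = 0 :=
  Function.iterate_fixed totalDeriv_zero N

namespace Represents

variable {F : ℝ × (Fin (k + 1) → ι → ℝ) → ℝ}

theorem jetPartial_eq (hF : Represents U k F f) (hU : IsOpen U) {p : JetCoord ι}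
    (hp : p ∈ jetDomain U) (l : ℕ) (i : ι) :
    jetPartial l i f p = fderiv ℝ F (truncate k p) (coordVec k l i) := by
  -- Along the coordinate line through `p`, the truncated point moves with velocity `coordVec k l i`.
  have hline (x : ℝ) :
      truncate k ((p.1, Function.update p.2 l (Function.update (p.2 l) i x)) : JetCoord ι) =
        truncate k p + (x - p.2 l i) • coordVec k l i := by
    ext j b
    · simp [truncate, coordVec]
    · by_cases hj : (j : ℕ) = l
      · by_cases hb : b = i
        · subst hj hb; simp [truncate, coordVec]
        · subst hj; simp [truncate, coordVec, hb]
      · simp [truncate, coordVec, hj]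
  have hd : HasDerivAt (fun x : ℝ => truncate k p + (x - p.2 l i) • coordVec k l i)
      (coordVec k l i) (p.2 l i) := by
    simpa using (((hasDerivAt_id (p.2 l i)).sub_const (p.2 l i)).smul_const
      (coordVec k l i)).const_add (truncate k p)
  have hF' : HasFDerivAt F (fderiv ℝ F (truncate k p))
      (truncate k p + (p.2 l i - p.2 l i) • coordVec k l i) := by
    simpa using (hF.differentiableAt hU (truncate_mem hp k)).hasFDerivAt
  refine Filter.EventuallyEq.deriv_eq ?_ |>.trans (hF'.comp_hasDerivAt _ hd).deriv
  filter_upwards [eventually_update_mem hU hp l i] with x hx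
  rw [hF.eqOn _ hx, hline, Function.comp_apply]

/-- The total derivative is the derivative along the vector `∂_t + ∑ q^i_{tΛ} ∂_i^Λ`. -/
theorem totalDeriv_eq (hF : Represents U k F f) (hU : IsOpen U) {p : JetCoord ι}
    (hp : p ∈ jetDomain U) :
    totalDeriv f p = fderiv ℝ F (truncate k p) (1, fun j => p.2 (j + 1)) := by
  have hvec : ((1, fun j => p.2 (j + 1)) : ℝ × (Fin (k + 1) → ι → ℝ)) =
      (1, 0) + ∑ l ∈ Finset.range (k + 1), ∑ i, p.2 (l + 1) i • coordVec k l i := by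
    ext j b
    · simp [coordVec, Prod.fst_sum]
    · have hj := j.isLt
      simp only [coordVec, Prod.snd_add, Prod.snd_sum, Prod.smul_snd, Pi.add_apply, Pi.zero_apply,
        zero_add, Finset.sum_apply, Pi.smul_apply, smul_eq_mul]
      rw [Finset.sum_eq_single_of_mem (j : ℕ) (Finset.mem_range.2 hj)]
      · simp [Pi.single_apply]
      · intro l _ hl
        simp [hl.symm]
  have hsupp : (Function.support fun l : ℕ => ∑ i, p.2 (l + 1) i * jetPartial l i f p) ⊆
      ↑(Finset.range (k + 1)) := by
    intro l hl
    by_contra hlk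
    refine hl (Finset.sum_eq_zero fun i _ => ?_)
    have hkl : k < l := by simpa using hlk
    rw [hF.jetPartial_eq hU hp, coordVec_eq_zero hkl, map_zero, mul_zero]
  rw [totalDeriv, finsum_eq_sum_of_support_subset _ hsupp, hF.deriv_time_eq hU hp, hvec, map_add,
    map_sum]
  simp only [map_sum, map_smul, smul_eq_mul, hF.jetPartial_eq hU hp]

theorem jetPartial (hF : Represents U k F f) (hU : IsOpen U) (l : ℕ) (i : ι) :
    Represents U k (fun x => fderiv ℝ F x (coordVec k l i)) (jetPartial l i f) where
  smooth := (hF.contDiffOn_fderiv hU).clm_apply contDiffOn_const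
  eqOn _ hp := hF.jetPartial_eq hU hp l i

theorem totalDeriv (hF : Represents U k F f) (hU : IsOpen U) :
    Represents U (k + 1)
      (fun x => fderiv ℝ F (x.1, fun j => x.2 j.castSucc) (1, fun j => x.2 j.succ))
      (totalDeriv f) where
  smooth := by
    have h : ContDiffOn ℝ ∞ (fun x : ℝ × (Fin (k + 1 + 1) → ι → ℝ) =>
        fderiv ℝ F (x.1, fun j => x.2 j.castSucc)) (finiteJetDomain (k + 1) U) :=
      (hF.contDiffOn_fderiv hU).comp (t := finiteJetDomain k U) (by fun_prop) fun _ hx => hx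
    exact h.clm_apply (by fun_prop)
  eqOn p hp := by simpa [truncate] using hF.totalDeriv_eq hU hp

/-- The commutator of `∂_i^Λ` and `d_t`. The second derivatives of `F` cancel by symmetry, and what
remains comes from the coefficients `q^i_{tΛ}` of `d_t`: the partial derivative of order `l - 1`,
or `0` if `l = 0`. -/
theorem jetPartial_totalDeriv (hF : Represents U k F f) (hU : IsOpen U) {p : JetCoord ι}
    (hp : p ∈ jetDomain U) (l : ℕ) (i : ι) :
    GaugeNoether.jetPartial l i (GaugeNoether.totalDeriv f) p =
      GaugeNoether.totalDeriv (GaugeNoether.jetPartial l i f) p +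
        fderiv ℝ F (truncate k p) (0, fun j => if (j : ℕ) + 1 = l then Pi.single i 1 else 0) := by
  rw [(hF.totalDeriv hU).jetPartial_eq hU hp, (hF.jetPartial hU l i).totalDeriv_eq hU hp]
  set x := truncate k p
  have hxm : x ∈ finiteJetDomain k U := truncate_mem hp k
  have hdd : HasFDerivAt (fderiv ℝ F) (fderiv ℝ (fderiv ℝ F) x) x :=
    (((hF.contDiffOn_fderiv hU).contDiffAt
      ((isOpen_finiteJetDomain hU k).mem_nhds hxm)).differentiableAt (by simp)).hasFDerivAt
  -- The projection to the jets of order `k`, and the shift that supplies the coefficients of `d_t`.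
  let R : (ℝ × (Fin (k + 1 + 1) → ι → ℝ)) →L[ℝ] (ℝ × (Fin (k + 1) → ι → ℝ)) :=
    (ContinuousLinearMap.fst ℝ _ _).prod (ContinuousLinearMap.pi fun j : Fin (k + 1) =>
      (ContinuousLinearMap.proj j.castSucc).comp (ContinuousLinearMap.snd ℝ _ _))
  let T : (ℝ × (Fin (k + 1 + 1) → ι → ℝ)) →L[ℝ] (ℝ × (Fin (k + 1) → ι → ℝ)) :=
    (0 : _ →L[ℝ] ℝ).prod (ContinuousLinearMap.pi fun j : Fin (k + 1) =>
      (ContinuousLinearMap.proj j.succ).comp (ContinuousLinearMap.snd ℝ _ _))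
  have hR : HasFDerivAt (fun y => fderiv ℝ F (R y)) ((fderiv ℝ (fderiv ℝ F) x).comp R)
      (truncate (k + 1) p) :=
    HasFDerivAt.comp (truncate (k + 1) p) (f := R) (g := fderiv ℝ F) hdd R.hasFDerivAt
  have hT : HasFDerivAt (fun y => ((1, 0) : ℝ × (Fin (k + 1) → ι → ℝ)) + T y) T
      (truncate (k + 1) p) := T.hasFDerivAt.const_add _
  have hG := (hR.clm_apply hT).fderiv
  have hfun : (fun y : ℝ × (Fin (k + 1 + 1) → ι → ℝ) =>
      fderiv ℝ F (y.1, fun j => y.2 j.castSucc) (1, fun j => y.2 j.succ)) =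
      fun y => fderiv ℝ F (R y) ((1, 0) + T y) := by
    funext y
    congr 1
    ext <;> simp [T]
  have hvel : ((1, 0) : ℝ × (Fin (k + 1) → ι → ℝ)) + T (truncate (k + 1) p) =
      (1, fun j : Fin (k + 1) => p.2 (j + 1)) := by
    ext <;> simp [T, truncate]
  have hRe : R (coordVec (k + 1) l i) = coordVec k l i := by
    ext <;> simp [R, coordVec]
  have hTe : T (coordVec (k + 1) l i) =
      (0, fun j : Fin (k + 1) => if (j : ℕ) + 1 = l then Pi.single i 1 else 0) := by
    ext <;> simp [T, coordVec]
  have hH := (hdd.clm_apply (hasFDerivAt_const (coordVec k l i) x)).fderiv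
  have hsymm : IsSymmSndFDerivAt ℝ F x :=
    (hF.contDiffAt hU hxm).isSymmSndFDerivAt (by
      rw [minSmoothness_of_isRCLikeNormedField]
      exact WithTop.coe_le_coe.2 (le_top : (2 : ℕ∞) ≤ ⊤))
  have hRx : R (truncate (k + 1) p) = x := rfl
  rw [hfun, hG, hH]
  simp only [_root_.add_apply, ContinuousLinearMap.comp_apply,
    ContinuousLinearMap.flip_apply, _root_.zero_apply, map_zero, zero_add, hvel, hRe,
    hTe, hRx]
  rw [hsymm.eq]
  ring

end Represents

/-! ### The total derivative on functions of finite order -/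

namespace IsFiniteOrder

theorem jetPartial (hf : IsFiniteOrder U f) (hU : IsOpen U) (l : ℕ) (i : ι) :
    IsFiniteOrder U (jetPartial l i f) :=
  let ⟨_, _, hF⟩ := hf
  ⟨_, _, hF.jetPartial hU l i⟩

theorem totalDeriv (hf : IsFiniteOrder U f) (hU : IsOpen U) : IsFiniteOrder U (totalDeriv f) :=
  let ⟨_, _, hF⟩ := hf
  ⟨_, _, hF.totalDeriv hU⟩

theorem totalDeriv_add (hf : IsFiniteOrder U f) (hg : IsFiniteOrder U g) (hU : IsOpen U) :
    Set.EqOn (GaugeNoether.totalDeriv (f + g))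
      (GaugeNoether.totalDeriv f + GaugeNoether.totalDeriv g) (jetDomain U) := by
  obtain ⟨k, F, G, hF, hG⟩ := hf.exists_represents hg
  intro p hp
  rw [Pi.add_apply, (hF.add hG).totalDeriv_eq hU hp, hF.totalDeriv_eq hU hp,
    hG.totalDeriv_eq hU hp, fderiv_add (hF.differentiableAt hU (truncate_mem hp k))
      (hG.differentiableAt hU (truncate_mem hp k)), _root_.add_apply]

theorem totalDeriv_iterate_add (hf : IsFiniteOrder U f) (hg : IsFiniteOrder U g) (hU : IsOpen U)
    (N : ℕ) : Set.EqOn (GaugeNoether.totalDeriv^[N] (f + g))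
      (GaugeNoether.totalDeriv^[N] f + GaugeNoether.totalDeriv^[N] g) (jetDomain U) := by
  induction N generalizing f g with
  | zero => exact fun _ _ => rfl
  | succ N ih =>
    simp only [Function.iterate_succ, Function.comp_apply]
    exact (totalDeriv_iterate_congr hU (hf.totalDeriv_add hg hU) N).trans
      (ih (hf.totalDeriv hU) (hg.totalDeriv hU))

theorem jetPartial_zero_totalDeriv (hf : IsFiniteOrder U f) (hU : IsOpen U) {p : JetCoord ι}
    (hp : p ∈ jetDomain U) (i : ι) :
    GaugeNoether.jetPartial 0 i (GaugeNoether.totalDeriv f) p =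
      GaugeNoether.totalDeriv (GaugeNoether.jetPartial 0 i f) p := by
  obtain ⟨k, F, hF⟩ := hf
  rw [hF.jetPartial_totalDeriv hU hp]
  simp only [Nat.add_eq_zero_iff, one_ne_zero, and_false, if_false]
  exact add_eq_left.2 (map_zero _)

theorem jetPartial_succ_totalDeriv (hf : IsFiniteOrder U f) (hU : IsOpen U) {p : JetCoord ι}
    (hp : p ∈ jetDomain U) (l : ℕ) (i : ι) :
    GaugeNoether.jetPartial (l + 1) i (GaugeNoether.totalDeriv f) p =
      GaugeNoether.totalDeriv (GaugeNoether.jetPartial (l + 1) i f) p +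
        GaugeNoether.jetPartial l i f p := by
  obtain ⟨k, F, hF⟩ := hf
  rw [hF.jetPartial_totalDeriv hU hp, hF.jetPartial_eq hU hp l i]
  simp only [Nat.add_right_cancel_iff, coordVec]

/-- A function of finite order does not depend on the jet coordinates of large order. -/
theorem exists_jetPartial_eq_zero (hf : IsFiniteOrder U f) (hU : IsOpen U) :
    ∃ k, ∀ l > k, ∀ i, Set.EqOn (GaugeNoether.jetPartial l i f) 0 (jetDomain U) := by
  obtain ⟨k, F, hF⟩ := hf
  refine ⟨k, fun l hl i p hp => ?_⟩
  rw [hF.jetPartial_eq hU hp, coordVec_eq_zero hl, map_zero, Pi.zero_apply]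

end IsFiniteOrder

/-- The integration by parts behind the Noether identities.
If `g_0 = d_t S_0` and `g_{l+1} = d_t S_{l+1} + S_l`, the sum `∑ (-1)^l d_t^l g_l` telescopes. -/
theorem sum_iterate_totalDeriv_eq (hU : IsOpen U) {g S : ℕ → JetCoord ι → ℝ}
    (hS : ∀ l, IsFiniteOrder U (S l)) (h0 : Set.EqOn (g 0) (totalDeriv (S 0)) (jetDomain U))
    (hsucc : ∀ l, Set.EqOn (g (l + 1)) (totalDeriv (S (l + 1)) + S l) (jetDomain U))
    {p : JetCoord ι} (hp : p ∈ jetDomain U) (N : ℕ) :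
    ∑ l ∈ Finset.range (N + 1), (-1 : ℝ) ^ l * (totalDeriv^[l] (g l)) p =
      (-1) ^ N * (totalDeriv^[N + 1] (S N)) p := by
  induction N with
  | zero => simpa using h0 hp
  | succ N ih =>
    rw [Finset.sum_range_succ, ih, totalDeriv_iterate_congr hU (hsucc N) (N + 1) hp,
      ((hS (N + 1)).totalDeriv hU).totalDeriv_iterate_add (hS N) hU (N + 1) hp, Pi.add_apply,
      ← Function.comp_apply (f := totalDeriv^[N + 1]) (g := totalDeriv),
      ← Function.iterate_succ, pow_succ]
    ring

end FiniteOrder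

/-! ### Linearization at vanishing gauge parameters -/

section ZeroParameter

variable {n d : ℕ}

/-- The jets of `Q` inside the jets of `Q ×_ℝ V`, as the jets with vanishing gauge parameters. -/
def withZeroParam (d : ℕ) (p : JetCoord (Fin n)) : JetCoord (Fin n ⊕ Fin d) :=
  (p.1, fun l => Sum.elim (p.2 l) 0)

theorem withZeroParam_inl (x : JetCoord (Fin n)) (l : ℕ) (i : Fin n) :
    (withZeroParam d x).2 l (Sum.inl i) = x.2 l i := rfl

theorem withZeroParam_inr (x : JetCoord (Fin n)) (l : ℕ) (b : Fin d) :
    (withZeroParam d x).2 l (Sum.inr b) = 0 := rfl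

/-- At vanishing gauge parameters the terms `χ^a_{tΛ} ∂/∂χ^a_Λ` of `d_t` vanish. -/
theorem totalDeriv_withZeroParam (f : JetCoord (Fin n ⊕ Fin d) → ℝ) (x : JetCoord (Fin n)) :
    totalDeriv f (withZeroParam d x) = totalDeriv (fun y => f (withZeroParam d y)) x := by
  have hupd (l : ℕ) (i : Fin n) (y : ℝ) :
      Function.update (withZeroParam d x).2 l
        (Function.update ((withZeroParam d x).2 l) (Sum.inl i) y) =
      (withZeroParam d (x.1, Function.update x.2 l (Function.update (x.2 l) i y))).2 := by
    funext l' b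
    by_cases hl : l' = l
    · subst hl
      rcases b with j | b
      · simp [Function.update_apply, withZeroParam_inl]
      · simp [withZeroParam_inr]
    · rcases b with j | b
      · simp [hl, withZeroParam_inl]
      · simp [hl, withZeroParam_inr]
  unfold totalDeriv jetPartial
  congr 1
  refine finsum_congr fun l => ?_
  rw [Fintype.sum_sum_type]
  simp only [hupd, withZeroParam_inl, withZeroParam_inr, zero_mul, Finset.sum_const_zero, add_zero]
  rfl

theorem IsFiniteOrder.comp_withZeroParam {U : Set (ℝ × (Fin n ⊕ Fin d → ℝ))}
    {f : JetCoord (Fin n ⊕ Fin d) → ℝ} (hf : IsFiniteOrder U f) :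
    IsFiniteOrder {y : ℝ × (Fin n → ℝ) | (y.1, Sum.elim y.2 0) ∈ U}
      (fun x => f (withZeroParam d x)) := by
  obtain ⟨k, F, hF⟩ := hf
  have hsmooth : ContDiff ℝ ∞ fun x : ℝ × (Fin (k + 1) → Fin n → ℝ) =>
      ((x.1, fun l => Sum.elim (x.2 l) 0) : ℝ × (Fin (k + 1) → Fin n ⊕ Fin d → ℝ)) := by
    refine contDiff_fst.prodMk (contDiff_pi.2 fun l => contDiff_pi.2 fun b => ?_)
    rcases b with i | a
    · simp only [Sum.elim_inl]; fun_prop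
    · simpa only [Sum.elim_inr] using contDiff_const
  exact ⟨k, fun x => F (x.1, fun l => Sum.elim (x.2 l) 0),
    hF.smooth.comp (t := finiteJetDomain k U) hsmooth.contDiffOn fun _ hx => hx,
    fun x hx => hF.eqOn (withZeroParam d x) hx⟩

/-- Extracting a coefficient of a linear function of the gauge parameters. -/
theorem jetPartial_inr_linear (m : ℕ) (g : ℕ → Fin d → JetCoord (Fin n) → ℝ) (l : ℕ) (a : Fin d)
    (x : JetCoord (Fin n)) :
    jetPartial l (Sum.inr a) (fun p : JetCoord (Fin n ⊕ Fin d) =>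
        ∑ l' ∈ Finset.range (m + 1), ∑ b, g l' b (toQ p) * p.2 l' (Sum.inr b))
      (withZeroParam d x) = if l ≤ m then g l a x else 0 := by
  have hQ (y : ℝ) : toQ (((withZeroParam d x).1, Function.update (withZeroParam d x).2 l
      (Function.update ((withZeroParam d x).2 l) (Sum.inr a) y)) :
        JetCoord (Fin n ⊕ Fin d)) = x := by
    refine Prod.ext rfl (funext fun l' => funext fun i => ?_)
    by_cases hl : l' = l
    · subst hl; simp [toQ, withZeroParam_inl]
    · simp [toQ, withZeroParam_inl, hl]
  have hχ (y : ℝ) (l' : ℕ) (b : Fin d) : Function.update (withZeroParam d x).2 l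
      (Function.update ((withZeroParam d x).2 l) (Sum.inr a) y) l' (Sum.inr b) =
        if l' = l then (if b = a then y else 0) else 0 := by
    by_cases hl : l' = l
    · subst hl
      by_cases hb : b = a
      · subst hb; simp
      · simp [withZeroParam_inr, hb]
    · simp [withZeroParam_inr, hl]
  unfold jetPartial
  simp only [hQ, hχ]
  by_cases hl : l ≤ m
  · simp [hl]
  · simp [hl]

end ZeroParameter

end GaugeNoether

end

/-! ### The Noether identities -/

open GaugeNoether in
theorem theorem2p6
    {EQ : Type*} [NormedAddCommGroup EQ] [NormedSpace ℝ EQ] [FiniteDimensional ℝ EQ]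
    {H : Type*} [TopologicalSpace H] (I : ModelWithCorners ℝ EQ H)
    {Q : Type*} [TopologicalSpace Q] [ChartedSpace H Q] [IsManifold I ∞ Q]
    {n : ℕ} {M : Type*} [TopologicalSpace M] [ChartedSpace (EuclideanSpace ℝ (Fin n)) M]
    [IsManifold (𝓡 n) ∞ M]
    (pr : Q → ℝ) (hpr : IsSmoothFibreBundle I pr n M)
    {d : ℕ} {V : ℝ → Type*} [∀ t, AddCommGroup (V t)] [∀ t, Module ℝ (V t)]
    [∀ t, TopologicalSpace (V t)] [TopologicalSpace (TotalSpace (EuclideanSpace ℝ (Fin d)) V)]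
    [FiberBundle (EuclideanSpace ℝ (Fin d)) V] [VectorBundle ℝ (EuclideanSpace ℝ (Fin d)) V]
    [ContMDiffVectorBundle ∞ (EuclideanSpace ℝ (Fin d)) V 𝓘(ℝ, ℝ)]
    {r k m : ℕ} (L : ∀ t, Jet I pr n r t → ℝ) (hL : IsSmoothOnJets L)
    (u : ∀ t, (j : Jet I pr n k t) → ParamJet d V m t → TangentSpace I j.point)
    (hu : IsVerticalGaugeSymmetry L u)
    (φ : FibredChart I pr n) (ψ : ParamChart d V) (hψ : ψ.IsLinear)
    (c : Fin n → ℕ → Fin d → JetCoord (Fin n) → ℝ) (hc : HasCoefficients u φ ψ c)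
    (a : Fin d) (p : JetCoord (Fin n))
    (hp : (p.1, p.2 0) ∈ φ.target) (hp' : (p.1, (0 : Fin d → ℝ)) ∈ ψ.target) :
    ∑ l ∈ Finset.range (m + 1), (-1 : ℝ) ^ l *
      (totalDeriv^[l] (fun x => ∑ i, c i l a x * lagrangeOperator L φ i x)) p = 0 := by
  obtain ⟨s, σ, hσ, hexact⟩ := hu.exact
  let W : Set (ℝ × (Fin n ⊕ Fin d → ℝ)) :=
    {y | (y.1, fun i => y.2 (Sum.inl i)) ∈ φ.target ∧ (y.1, fun b => y.2 (Sum.inr b)) ∈ ψ.target}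
  let U : Set (ℝ × (Fin n → ℝ)) := {y | (y.1, Sum.elim y.2 0) ∈ W}
  have hW : IsOpen W :=
    (φ.open_target.preimage (by fun_prop)).inter (ψ.open_target.preimage (by fun_prop))
  have hU : IsOpen U := by
    refine hW.preimage (continuous_fst.prodMk (continuous_pi fun b => ?_))
    rcases b with i | b
    · simp only [Sum.elim_inl]; fun_prop
    · simpa only [Sum.elim_inr] using continuous_const
  have hpU : p ∈ jetDomain U := ⟨hp, hp'⟩
  let f := coordExpr₂ σ φ ψ
  have hf : IsFiniteOrder W f := by
    refine ⟨s, fun x => coordFun₂ σ φ ψ (x.1, fun l i => x.2 l (Sum.inl i),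
      fun l b => x.2 l (Sum.inr b)), ?_, fun _ _ => rfl⟩
    exact (hσ φ ψ hψ).comp (by fun_prop) fun _ hx => hx
  let g : ℕ → Fin d → JetCoord (Fin n) → ℝ := fun l b x =>
    ∑ i, c i l b x * lagrangeOperator L φ i x
  let S : ℕ → JetCoord (Fin n) → ℝ := fun l x => jetPartial l (Sum.inr a) f (withZeroParam d x)
  have hS (l : ℕ) : IsFiniteOrder U (S l) := (hf.jetPartial hW l (Sum.inr a)).comp_withZeroParam
  -- Both sides of `u ⌋ δL = d_H σ` are linear in the jets of the gauge parameters.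
  have hlin : Set.EqOn (totalDeriv f)
      (fun q => ∑ l ∈ Finset.range (m + 1), ∑ b, g l b (toQ q) * q.2 l (Sum.inr b))
      (jetDomain W) := by
    intro q hq
    rw [← hexact φ ψ hψ q hq, Finset.sum_congr rfl fun i _ => by rw [hc i q hq]]
    simp only [g, Finset.sum_mul]
    rw [Finset.sum_comm]
    refine Finset.sum_congr rfl fun l _ => ?_
    rw [Finset.sum_comm]
    exact Finset.sum_congr rfl fun b _ => Finset.sum_congr rfl fun i _ => by ring
  -- The coefficients of `χ^a_Λ` in `d_t σ`, extended by zero to the orders above `m`.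
  let G : ℕ → JetCoord (Fin n) → ℝ := fun l => if l ≤ m then g l a else 0
  have hG {x : JetCoord (Fin n)} (hx : x ∈ jetDomain U) (l : ℕ) :
      G l x = jetPartial l (Sum.inr a) (totalDeriv f) (withZeroParam d x) := by
    rw [jetPartial_congr hW hlin l (Sum.inr a) (show withZeroParam d x ∈ jetDomain W from hx),
      jetPartial_inr_linear]
    by_cases hl : l ≤ m <;> simp [G, hl]
  -- The order `m + (N + 1)` exceeds both the order of `u` in the parameters and that of `σ`.
  obtain ⟨N, hN⟩ := hf.exists_jetPartial_eq_zero hW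
  have htel := sum_iterate_totalDeriv_eq hU (g := G) hS
    (fun x hx => by
      rw [hG hx, hf.jetPartial_zero_totalDeriv hW hx, totalDeriv_withZeroParam])
    (fun l x hx => by
      rw [hG hx, hf.jetPartial_succ_totalDeriv hW hx, totalDeriv_withZeroParam, Pi.add_apply])
    hpU (m + (N + 1))
  have hSN : Set.EqOn (S (m + (N + 1))) 0 (jetDomain U) := fun x hx =>
    hN _ (by omega) (Sum.inr a) hx
  rw [totalDeriv_iterate_congr hU hSN _ hpU, totalDeriv_iterate_zero, Pi.zero_apply, mul_zero] at htel
  rw [← htel]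
  refine Eq.trans (Finset.sum_congr rfl fun l hl => ?_)
    (Finset.sum_subset (Finset.range_mono (by omega)) fun l _ hl => ?_)
  · have hlm : l ≤ m := Nat.lt_succ_iff.1 (Finset.mem_range.1 hl)
    simp only [G, hlm, if_true, g]
  · have hlm : ¬ l ≤ m := fun h => hl (Finset.mem_range.2 (Nat.lt_succ_iff.2 h))
    simp only [G, hlm, if_false, totalDeriv_iterate_zero, Pi.zero_apply, mul_zero]
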